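/- Let $G$ be a finite connected simple graph with at least two vertices, with adjacency matrix $A$ and diagonal degree matrix $D$. Let $B$ be its non-backtracking matrix, i.e. the $0/1$ matrix indexed by the ordered pairs $(u,v)$ with $u\sim v$, given by $B((u,v),(x,y))=1$ if $v=x$ and $u\neq y$, and $0$ otherwise. Let $$K=\begin{bmatrix}A & D-I\\ -I & 0\end{bmatrix}.$$ Write $\sigma(\cdot)$ for the set of complex eigenvalues of a matrix, and call it symmetric if $z\in\sigma$ implies $-z\in\sigma$. The largest (smallest) eigenvalue of a matrix means a real eigenvalue that is at least (at most) the real part of every complex eigenvalue. Then $K$ and $B$ have largest eigenvalues $\lambda_1$ and $\mu_1$, which equal the spectral radii of $K$ and $B$ respectively, and the following are equivalent: 1. $G$ is bipartite; 2. $\sigma(K)$ is symmetric; 3. $\sigma(K)$ is symmetric and, moreover, $z$ and $-z$ always have the same algebraic multiplicity; 4. $\sigma(B)$ is symmetric; 5. $\sigma(B)$ is symmetric and, moreover, $z$ and $-z$ always have the same algebraic multiplicity; 6. $-\lambda_1$ is the smallest eigenvalue of $K$; 7. $-\mu_1$ is the smallest eigenvalue of $B$; 8. $-1\in\sigma(K)$.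 -/

import Mathlib

/-- The non-backtracking matrix `B` of a finite simple graph, with rows and columns indexed by the
oriented edges (darts) `(u, v)`: the entry at `((u, v), (x, y))` is `1` if `v = x` and `u ≠ y`,
and `0` otherwise. -/
def nonBacktrackingMatrix {V : Type*} [DecidableEq V] (G : SimpleGraph V) :
    Matrix G.Dart G.Dart ℂ :=
  Matrix.of fun e f => if e.snd = f.fst ∧ e.fst ≠ f.snd then 1 else 0

/-- The block matrix `K = [[A, D - I], [-I, 0]]`, where `A` is the adjacency matrix and `D` the
diagonal degree matrix. -/
def blockMatrixK {V : Type*} [Fintype V] [DecidableEq V] (G : SimpleGraph V)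
    [DecidableRel G.Adj] : Matrix (V ⊕ V) (V ⊕ V) ℂ :=
  Matrix.fromBlocks (G.adjMatrix ℂ) (G.degMatrix ℂ - 1) (-1) 0

/-- The set of complex eigenvalues of `M` is symmetric about `0`. -/
def HasSymmetricSpectrum {ι : Type*} [Fintype ι] [DecidableEq ι] (M : Matrix ι ι ℂ) : Prop :=
  ∀ z : ℂ, z ∈ spectrum ℂ M → -z ∈ spectrum ℂ M

/-- The complex eigenvalues of `M` are symmetric about `0`, with algebraic multiplicities. -/
def HasSymmetricSpectrumWithMult {ι : Type*} [Fintype ι] [DecidableEq ι]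
    (M : Matrix ι ι ℂ) : Prop :=
  ∀ z : ℂ, M.charpoly.rootMultiplicity (-z) = M.charpoly.rootMultiplicity z

/-- `r` is the largest eigenvalue of `M`: a real eigenvalue that is at least the real part of every
complex eigenvalue. -/
def IsLargestEigenvalue {ι : Type*} [Fintype ι] [DecidableEq ι] (M : Matrix ι ι ℂ)
    (r : ℝ) : Prop :=
  (r : ℂ) ∈ spectrum ℂ M ∧ ∀ z ∈ spectrum ℂ M, z.re ≤ r

/-- `s` is the smallest eigenvalue of `M`: a real eigenvalue that is at most the real part of every
complex eigenvalue. -/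
def IsSmallestEigenvalue {ι : Type*} [Fintype ι] [DecidableEq ι] (M : Matrix ι ι ℂ)
    (s : ℝ) : Prop :=
  (s : ℂ) ∈ spectrum ℂ M ∧ ∀ z ∈ spectrum ℂ M, s ≤ z.re

/-!
For a graph with `n` vertices and `m` edges everything is read off from the real symmetric pencil
`P(t) = t² - t A + (D - I) = t L + (t - 1) (t + 1 - D)`, where `L = D - A` is the Laplacian.

A complex number `z ≠ 0` is an eigenvalue of `K` iff `det P(z) = 0`, by a Schur complement
(`mem_spectrum_blockMatrixK_iff`). The Ihara–Bass formula
`χ_B (X² - 1)ⁿ = (X² - 1)ᵐ χ_K` (`ihara_bass`) shows that `B` and `K` have the same eigenvalues away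
from `±1`, and compares the multiplicities of `±1`. The spectral radius `μ₁` of `B` is an eigenvalue
since `B` is nonnegative (`Matrix.exists_mem_spectrum_norm_le_of_nonneg`), and `1` is an eigenvalue
of `K` since `P(1) = L` is singular; hence `λ₁ = max 1 μ₁` is the spectral radius of `K` and an
eigenvalue.

If `G` is bipartite, a diagonal matrix of signs conjugates `K` to `-K` and `B` to `-B`, which gives
the symmetry with multiplicities. The converse rests on a variational argument
(`isBipartite_of_det_iharaPencil_neg_eq_zero`): if `P(t)` is positive semidefinite, `t > 0`, and
`P(-t) x = 0` with `x ≠ 0`, then `|x|` is a zero of the quadratic form of `P(t)`. Equality in the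
triangle inequality makes `x` change its sign along every edge, and connectedness makes `x` nowhere
zero, so that the sign of `x` is a proper 2-colouring. The pencil is positive semidefinite at
`t = 1`, which deals with the eigenvalue `-1` of `K`, and at `t = λ₁`, since `P(t)` is positive
semidefinite for large `t` and nonsingular for `t > λ₁`; this deals with `-λ₁`.

Suppose finally that `-μ₁` is an eigenvalue of `B`. If `μ₁ > 1`, then `-λ₁` is an eigenvalue of `K`.
Otherwise `λ₁ = 1`; testing `P(t)`, `t > 1`, on the constant vector gives `m ≤ n`, and the
comparison of the multiplicities of `±1` shows that `-1` is an eigenvalue of `K`.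
-/

open Matrix

/-! ### Perron–Frobenius for nonnegative matrices -/

open scoped ComplexOrder in
attribute [local instance] Matrix.linftyOpNormedRing Matrix.linftyOpNormedAlgebra in
/-- For a nonnegative matrix, the Neumann series of `(1 - s N)⁻¹` converges as long as `s` is
smaller than the inverse of the spectral radius, so that inverse is nonnegative. -/
theorem Matrix.ringInverse_one_sub_smul_nonneg {ι : Type*} [Fintype ι] [DecidableEq ι]
    {N : Matrix ι ι ℂ} (hN : ∀ i j, 0 ≤ N i j) {s : ℝ} (hs : 0 ≤ s)
    (hsN : ∀ z ∈ spectrum ℂ N, s * ‖z‖ < 1) (i j : ι) :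
    0 ≤ Ring.inverse (1 - (s : ℂ) • N) i j := by
  have : Nonempty ι := ⟨i⟩
  rcases hs.eq_or_lt with rfl | hs
  · by_cases h : i = j <;> simp [h]
  obtain ⟨z, hz, hzr⟩ := spectrum.exists_nnnorm_eq_spectralRadius N
  -- a radius `q` strictly between `s` and the inverse of the spectral radius
  obtain ⟨q, hsq, hq⟩ : ∃ q : NNReal, s < q ∧ (q : ENNReal) < (spectralRadius ℂ N)⁻¹ := by
    have h : ENNReal.ofReal s < (spectralRadius ℂ N)⁻¹ := by
      rw [← hzr, ENNReal.lt_inv_iff_lt_inv, ← ENNReal.ofReal_inv_of_pos hs,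
        ← ENNReal.ofReal_coe_nnreal, ENNReal.ofReal_lt_ofReal_iff (inv_pos.2 hs), coe_nnnorm]
      rw [← one_div, lt_div_iff₀' hs]
      exact hsN z hz
    obtain ⟨q, h1, h2⟩ := ENNReal.lt_iff_exists_nnreal_btwn.1 h
    exact ⟨q, (ENNReal.ofReal_lt_coe_iff hs.le).1 h1, h2⟩
  have hq0 : 0 < q := by exact_mod_cast hs.trans hsq
  have H := (spectrum.hasFPowerSeriesOnBall_inverse_one_sub_smul ℂ N).exchange_radius
    ((spectrum.differentiableOn_inverse_one_sub_smul hq).hasFPowerSeriesOnBall hq0)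
  have hsum := H.hasSum (y := (s : ℂ)) (by
    rw [Metric.mem_eball, edist_zero_right, enorm_eq_nnnorm, ENNReal.coe_lt_coe]
    rw [← NNReal.coe_lt_coe]
    simpa [abs_of_pos hs] using hsq)
  simp only [zero_add] at hsum
  have hent := (Pi.hasSum.1 (Pi.hasSum.1 hsum i) j)
  refine hent.nonneg fun n => ?_
  have hpow : ∀ n, ∀ i j, 0 ≤ (N ^ n) i j := by
    intro n
    induction n with
    | zero => intro i j; by_cases h : i = j <;> simp [h]
    | succ n ih =>
      intro i j
      rw [pow_succ, Matrix.mul_apply]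
      exact Finset.sum_nonneg fun k _ => mul_nonneg (ih i k) (hN k j)
  simp only [ContinuousMultilinearMap.mkPiRing_apply, Finset.prod_const, Finset.card_univ,
    Fintype.card_fin, Matrix.smul_apply, smul_eq_mul]
  exact mul_nonneg (pow_nonneg (by exact_mod_cast hs.le) n) (hpow n i j)

open scoped ComplexOrder in
attribute [local instance] Matrix.linftyOpNormedRing Matrix.linftyOpNormedAlgebra in
/-- **Perron–Frobenius**, without irreducibility: the spectral radius of a nonnegative matrix is an
eigenvalue. -/
theorem Matrix.exists_mem_spectrum_norm_le_of_nonneg {ι : Type*} [Fintype ι] [DecidableEq ι]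
    [Nonempty ι] {N : Matrix ι ι ℂ} (hN : ∀ i j, 0 ≤ N i j) :
    ∃ r : ℝ, (r : ℂ) ∈ spectrum ℂ N ∧ ∀ z ∈ spectrum ℂ N, ‖z‖ ≤ r := by
  obtain ⟨z₀, hz₀, hzr⟩ := spectrum.exists_nnnorm_eq_spectralRadius N
  have hmax : ∀ z ∈ spectrum ℂ N, ‖z‖ ≤ ‖z₀‖ := fun z hz => by
    have h : (‖z‖₊ : ENNReal) ≤ ‖z₀‖₊ := hzr ▸ le_iSup₂ (f := fun k (_ : k ∈ spectrum ℂ N) =>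
      (‖k‖₊ : ENNReal)) z hz
    exact_mod_cast h
  refine ⟨‖z₀‖, ?_, hmax⟩
  rcases (norm_nonneg z₀).eq_or_lt with h0 | hpos
  · rw [← h0]; rw [norm_eq_zero.1 h0.symm] at hz₀; simpa using hz₀
  by_contra hr
  set r := ‖z₀‖ with hr_def
  -- an eigenvector for `z₀` and the vector of its absolute values
  obtain ⟨x, hx0, hx⟩ : ∃ x ≠ 0, N *ᵥ x = z₀ • x := by
    rw [← Matrix.spectrum_toLin', ← Module.End.hasEigenvalue_iff_mem_spectrum] at hz₀
    obtain ⟨x, hx⟩ := hz₀.exists_hasEigenvector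
    exact ⟨x, hx.2, by simpa using hx.apply_eq_smul⟩
  let y : ι → ℂ := fun i => (‖x i‖ : ℂ)
  have hy : ∀ i, (r : ℂ) * y i ≤ (N *ᵥ y) i := by
    intro i
    have h1 : r * ‖x i‖ ≤ ∑ j, ‖N i j‖ * ‖x j‖ := by
      have := congrFun hx i
      rw [Pi.smul_apply, smul_eq_mul] at this
      rw [hr_def, ← norm_mul, ← this, Matrix.mulVec, dotProduct]
      exact (norm_sum_le _ _).trans_eq (Finset.sum_congr rfl fun j _ => norm_mul _ _)
    have h2 : (N *ᵥ y) i = ((∑ j, ‖N i j‖ * ‖x j‖ : ℝ) : ℂ) := by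
      simp only [Matrix.mulVec, dotProduct, y]
      push_cast
      exact Finset.sum_congr rfl fun j _ => by rw [Complex.norm_of_nonneg' (hN i j)]
    rw [h2]
    simp only [y]
    exact_mod_cast h1
  have hunit : IsUnit (1 - ((r⁻¹ : ℝ) : ℂ) • N) := by
    have h := spectrum.notMem_iff.1 hr
    have h' : 1 - ((r⁻¹ : ℝ) : ℂ) • N =
        algebraMap ℂ (Matrix ι ι ℂ) ((r⁻¹ : ℝ) : ℂ) * (algebraMap ℂ (Matrix ι ι ℂ) r - N) := by
      rw [mul_sub, ← map_mul, ← Algebra.smul_def]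
      simp [hpos.ne']
    rw [h']
    exact ((IsUnit.mk0 _ (by exact_mod_cast (inv_pos.2 hpos).ne')).map _).mul h
  -- `y ≤ (1 - s r) (1 - s N)⁻¹ y` for `s < r⁻¹`, whose right side tends to `0` as `s → r⁻¹`
  have key : ∀ i, ∀ s ∈ Set.Ioo 0 r⁻¹,
      y i ≤ ((1 - s * r : ℝ) : ℂ) * (Ring.inverse (1 - (s : ℂ) • N) *ᵥ y) i := by
    intro i s hs
    have hsr : s * r < 1 := by
      have := mul_lt_mul_of_pos_right hs.2 hpos
      rwa [inv_mul_cancel₀ hpos.ne'] at this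
    have hspec : ∀ z ∈ spectrum ℂ N, s * ‖z‖ < 1 := fun z hz =>
      (mul_le_mul_of_nonneg_left (hmax z hz) hs.1.le).trans_lt hsr
    have hU : IsUnit (1 - (s : ℂ) • N) := by
      have h : ((s⁻¹ : ℝ) : ℂ) ∉ spectrum ℂ N := fun h => by
        have := hspec _ h
        rw [Complex.norm_real, Real.norm_of_nonneg (inv_nonneg.2 hs.1.le),
          mul_inv_cancel₀ hs.1.ne'] at this
        exact lt_irrefl _ this
      have h' : 1 - (s : ℂ) • N =
          algebraMap ℂ (Matrix ι ι ℂ) s * (algebraMap ℂ (Matrix ι ι ℂ) (s⁻¹ : ℝ) - N) := by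
        rw [mul_sub, ← map_mul, ← Algebra.smul_def]
        simp [hs.1.ne']
      rw [h']
      exact ((IsUnit.mk0 _ (by exact_mod_cast hs.1.ne')).map _).mul (spectrum.notMem_iff.1 h)
    have hW := Matrix.ringInverse_one_sub_smul_nonneg hN hs.1.le hspec
    have hyW : y = Ring.inverse (1 - (s : ℂ) • N) *ᵥ ((1 - (s : ℂ) • N) *ᵥ y) := by
      rw [Matrix.mulVec_mulVec, Ring.inverse_mul_cancel _ hU, Matrix.one_mulVec]
    conv_lhs => rw [hyW]
    rw [← smul_eq_mul, ← Pi.smul_apply, ← Matrix.mulVec_smul]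
    refine Finset.sum_le_sum fun j _ => mul_le_mul_of_nonneg_left ?_ (hW i j)
    rw [Matrix.sub_mulVec, Matrix.one_mulVec, Matrix.smul_mulVec, Pi.sub_apply, Pi.smul_apply,
      smul_eq_mul]
    have : (s : ℂ) * (r * y j) ≤ s * (N *ᵥ y) j :=
      mul_le_mul_of_nonneg_left (hy j) (by exact_mod_cast hs.1.le)
    calc y j - s * (N *ᵥ y) j ≤ y j - s * (r * y j) := sub_le_sub_left this _
      _ = _ := by rw [Pi.smul_apply, smul_eq_mul]; push_cast; ring
  refine hx0 (funext fun i => ?_)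
  have hlim : Filter.Tendsto (fun s : ℝ => ((1 - s * r : ℝ) : ℂ) *
      (Ring.inverse (1 - (s : ℂ) • N) *ᵥ y) i) (nhdsWithin r⁻¹ (Set.Iio r⁻¹)) (nhds 0) := by
    have hc : ContinuousAt (fun s : ℝ => ((1 - s * r : ℝ) : ℂ) *
        (Ring.inverse (1 - (s : ℂ) • N) *ᵥ y) i) r⁻¹ := by
      have h1 : ContinuousAt (fun s : ℝ => Ring.inverse (1 - (s : ℂ) • N)) r⁻¹ := by
        have h2 := NormedRing.inverse_continuousAt hunit.unit
        rw [hunit.unit_spec] at h2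
        exact ContinuousAt.comp (f := fun s : ℝ => 1 - (s : ℂ) • N) h2 (by fun_prop)
      have h3 : ContinuousAt (fun s : ℝ => Ring.inverse (1 - (s : ℂ) • N) *ᵥ y) r⁻¹ :=
        ContinuousAt.comp (f := fun s : ℝ => Ring.inverse (1 - (s : ℂ) • N))
          (g := fun W : Matrix ι ι ℂ => W *ᵥ y)
          (Continuous.continuousAt (by fun_prop)) h1
      exact ContinuousAt.mul (by fun_prop) ((continuous_apply i).continuousAt.comp h3)
    have := hc.tendsto.mono_left (nhdsWithin_le_nhds (s := Set.Iio r⁻¹))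
    simpa [inv_mul_cancel₀ hpos.ne', hpos.ne'] using this
  have hle : y i ≤ 0 := ge_of_tendsto hlim
    (Filter.mem_of_superset (Ioo_mem_nhdsLT (inv_pos.2 hpos)) fun s hs => key i s hs)
  have h0 : ‖x i‖ ≤ 0 := by
    simp only [y] at hle
    exact_mod_cast hle
  exact norm_le_zero_iff.1 h0

/-! ### The Ihara–Bass formula -/

namespace SimpleGraph

variable {V : Type*} [Fintype V] [DecidableEq V] (G : SimpleGraph V) [DecidableRel G.Adj]

/-- The incidence matrix between vertices and the darts that start there. -/
def dartStartMatrix : Matrix V G.Dart ℂ := Matrix.of fun v e => if e.fst = v then 1 else 0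

/-- The incidence matrix between vertices and the darts that end there. -/
def dartEndMatrix : Matrix V G.Dart ℂ := Matrix.of fun v e => if e.snd = v then 1 else 0

/-- The permutation matrix of dart reversal. -/
def dartReversalMatrix : Matrix G.Dart G.Dart ℂ := Matrix.of fun e f => if e.symm = f then 1 else 0

theorem dartReversalMatrix_mul_self : G.dartReversalMatrix * G.dartReversalMatrix = 1 := by
  ext e f
  rw [Matrix.mul_apply, Finset.sum_eq_single e.symm]
  · simp [dartReversalMatrix, Matrix.one_apply]
  · intro g _ hg
    simp [dartReversalMatrix, hg.symm]
  · simp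

theorem dartStartMatrix_mul_dartReversalMatrix :
    G.dartStartMatrix * G.dartReversalMatrix = G.dartEndMatrix := by
  ext v e
  have h : ∀ f : G.Dart, f.symm = e ↔ f = e.symm := fun f =>
    ⟨fun h => by rw [← h, Dart.symm_symm], fun h => by rw [h, Dart.symm_symm]⟩
  simp [dartReversalMatrix, dartStartMatrix, dartEndMatrix, Matrix.mul_apply, h]

theorem dartStartMatrix_mul_transpose_dartEndMatrix :
    G.dartStartMatrix * G.dartEndMatrixᵀ = G.adjMatrix ℂ := by
  ext u v
  simp only [dartStartMatrix, dartEndMatrix, Matrix.mul_apply, Matrix.of_apply,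
    Matrix.transpose_apply, ← ite_and, mul_ite, mul_one, mul_zero, SimpleGraph.adjMatrix_apply]
  by_cases h : G.Adj u v
  · rw [Finset.sum_eq_single (⟨(u, v), h⟩ : G.Dart)]
    · simp [h]
    · intro e _ he
      refine if_neg fun h' => he ?_
      ext
      exacts [h'.2, h'.1]
    · simp
  · rw [if_neg h]
    refine Finset.sum_eq_zero fun e _ => if_neg fun h' => h ?_
    rw [← h'.1, ← h'.2]
    exact e.adj

theorem dartEndMatrix_mul_transpose_self :
    G.dartEndMatrix * G.dartEndMatrixᵀ = G.degMatrix ℂ := by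
  ext u v
  simp only [dartEndMatrix, degMatrix, Matrix.mul_apply, Matrix.of_apply,
    Matrix.transpose_apply, ← ite_and, mul_ite, mul_one, mul_zero]
  by_cases h : u = v
  · subst h
    rw [Matrix.diagonal_apply_eq, ← G.dart_fst_fiber_card_eq_degree]
    simp only [and_self, Finset.sum_boole]
    congr 1
    exact Finset.card_bij (fun e _ => e.symm) (by simp)
      (fun _ _ _ _ h => Dart.symm_involutive.injective h)
      (fun e he => ⟨e.symm, by simpa using he, by simp⟩)
  · rw [Matrix.diagonal_apply_ne _ h]
    exact Finset.sum_eq_zero fun e _ => if_neg fun h' => h (h'.2.symm.trans h'.1)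

omit [DecidableRel G.Adj] in
/-- The product `TᵀS` of the end and start incidences records all continuations of a dart by a dart;
subtracting the dart reversal removes the backtracking one. -/
theorem nonBacktrackingMatrix_eq :
    nonBacktrackingMatrix G = G.dartEndMatrixᵀ * G.dartStartMatrix - G.dartReversalMatrix := by
  ext e f
  have h : e.symm = f ↔ f.fst = e.snd ∧ e.fst = f.snd := by
    rw [SimpleGraph.Dart.ext_iff, Prod.ext_iff]
    exact and_congr_left' eq_comm
  simp only [nonBacktrackingMatrix, dartStartMatrix, dartEndMatrix, dartReversalMatrix,
    Matrix.sub_apply, Matrix.mul_apply, Matrix.of_apply, Matrix.transpose_apply, h]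
  rw [Finset.sum_eq_single e.snd (fun v _ hv => by simp [hv.symm]) (by simp)]
  by_cases h1 : f.fst = e.snd <;> by_cases h2 : e.fst = f.snd <;> simp [h1, h2, eq_comm]

open Polynomial in
/-- Dart reversal swaps the two darts of each edge, so its characteristic polynomial
is `(X² - 1)ᵐ`. -/
theorem charpoly_neg_dartReversalMatrix :
    (-G.dartReversalMatrix).charpoly = (X ^ 2 - 1) ^ G.edgeFinset.card := by
  set J := G.dartReversalMatrix with hJ
  -- an orientation of the edges conjugates `J` to `-J`
  let ε : G.Dart → ℂ := fun e =>
    if Fintype.equivFin V e.fst < Fintype.equivFin V e.snd then 1 else -1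
  have hε : ∀ e, ε e * ε e = 1 := fun e => by simp only [ε]; split_ifs <;> simp
  have hεs : ∀ e, ε e.symm = - ε e := fun e => by
    have hne : Fintype.equivFin V e.fst ≠ Fintype.equivFin V e.snd :=
      fun h => e.adj.ne ((Fintype.equivFin V).injective h)
    simp only [ε, SimpleGraph.Dart.symm, Prod.fst_swap, Prod.snd_swap]
    rcases hne.lt_or_gt with h | h
    · simp [h, h.not_gt]
    · simp [h, h.not_gt]
  have hE : diagonal ε * diagonal ε = 1 := by simp [hε]
  have hconj : diagonal ε * J * diagonal ε = -J := by
    ext e f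
    rw [mul_diagonal, diagonal_mul, hJ, dartReversalMatrix, Matrix.neg_apply, of_apply]
    split_ifs with h
    · rw [← h, hεs, mul_one, mul_neg, hε]
    · simp
  have hsymm : (-J).charpoly = J.charpoly := by
    rw [← hconj, charpoly_mul_comm, ← mul_assoc, hE, one_mul]
  have hsq : (-J).charpoly ^ 2 = ((X ^ 2 - 1) ^ G.edgeFinset.card) ^ 2 := by
    refine Polynomial.funext fun z => ?_
    rw [sq]
    nth_rw 2 [hsymm]
    rw [eval_mul, eval_charpoly, eval_charpoly, ← det_mul]
    have : (scalar G.Dart z - -J) * (scalar G.Dart z - J) = (z ^ 2 - 1) • (1 : Matrix _ _ ℂ) := by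
      have hs : scalar G.Dart z = z • (1 : Matrix _ _ ℂ) := by
        rw [smul_one_eq_diagonal]; rfl
      rw [hs, sub_neg_eq_add, add_mul, mul_sub, mul_sub, dartReversalMatrix_mul_self]
      simp only [smul_mul_assoc, mul_smul_comm, one_mul, mul_one, smul_smul, sub_smul, sq, one_smul]
      abel
    rw [this, det_smul, det_one, G.dart_card_eq_twice_card_edges]
    simp [pow_mul']
  have hm : ((X ^ 2 - 1 : ℂ[X]) ^ G.edgeFinset.card).Monic :=
    (monic_X_pow_sub_C (1 : ℂ) two_ne_zero).pow _
  rcases sq_eq_sq_iff_eq_or_eq_neg.1 hsq with h | h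
  · exact h
  · have h1 := congrArg leadingCoeff h
    rw [leadingCoeff_neg, hm.leadingCoeff, (charpoly_monic _).leadingCoeff] at h1
    norm_num at h1

/-- The quadratic matrix pencil `z² - z A + (D - I)`, written as `(z² - 1) I - z A + D`. It is
singular exactly at the eigenvalues of `K`. -/
def iharaPencil {R : Type*} [CommRing R] (z : R) : Matrix V V R :=
  (z ^ 2 - 1) • 1 - z • G.adjMatrix R + G.degMatrix R

/-- Schur complement with respect to the lower right block `z` of `z - K`. -/
theorem eval_charpoly_blockMatrixK {z : ℂ} (hz : z ≠ 0) :
    (blockMatrixK G).charpoly.eval z = (G.iharaPencil z).det := by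
  have hs : scalar (V ⊕ V) z - blockMatrixK G =
      fromBlocks (z • 1 - G.adjMatrix ℂ) (1 - G.degMatrix ℂ) 1 (z • 1) := by
    have : scalar (V ⊕ V) z = fromBlocks (z • 1) 0 0 (z • 1) := by
      rw [smul_one_eq_diagonal, fromBlocks_diagonal, scalar_apply]
      congr 1
      ext i
      cases i <;> rfl
    rw [this, blockMatrixK, sub_eq_add_neg, fromBlocks_neg, fromBlocks_add]
    congr 1 <;> simp [sub_eq_add_neg]
  let : Invertible (z • 1 : Matrix V V ℂ) := ⟨z⁻¹ • 1, by simp [hz], by simp [hz]⟩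
  have hinv : ⅟(z • 1 : Matrix V V ℂ) = z⁻¹ • 1 := rfl
  rw [eval_charpoly, hs, det_fromBlocks₂₂, hinv, ← det_mul]
  congr 1
  simp only [iharaPencil, smul_mul_assoc, mul_smul_comm, one_mul, mul_one, mul_sub, smul_sub,
    smul_smul, inv_mul_cancel₀ hz, one_smul, sub_smul, sq]
  abel

theorem mem_spectrum_blockMatrixK_iff {z : ℂ} (hz : z ≠ 0) :
    z ∈ spectrum ℂ (blockMatrixK G) ↔ (G.iharaPencil z).det = 0 := by
  rw [mem_spectrum_iff_isRoot_charpoly, Polynomial.IsRoot, eval_charpoly_blockMatrixK G hz]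

open Polynomial in
/-- The **Ihara–Bass formula**, in terms of characteristic polynomials. With `B = TᵀS - J`, where
`J` is the dart reversal, `z - B` factors through `z + J`, whose inverse is
`(z² - 1)⁻¹ (z - J)`, and the Weinstein–Aronszajn identity moves the remaining determinant from
darts to vertices. -/
theorem ihara_bass :
    (nonBacktrackingMatrix G).charpoly * (X ^ 2 - 1) ^ Fintype.card V =
      (X ^ 2 - 1) ^ G.edgeFinset.card * (blockMatrixK G).charpoly := by
  -- it suffices to compare values at `z ∉ {0, 1, -1}`, where `z` and `z² - 1` are invertible
  refine eq_of_infinite_eval_eq _ _ (Set.Infinite.mono (s := {0, 1, -1}ᶜ) (fun z hz => ?_)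
    (Set.Finite.infinite_compl (by simp)))
  simp only [Set.mem_compl_iff, Set.mem_insert_iff, Set.mem_singleton_iff, not_or] at hz
  obtain ⟨hz0, hz1, hz2⟩ := hz
  set w := z ^ 2 - 1 with hw_def
  have hw : w ≠ 0 := by
    rw [hw_def, sub_ne_zero, Ne, sq_eq_one_iff]
    tauto
  have hs : scalar G.Dart z = z • (1 : Matrix _ _ ℂ) := by
    rw [smul_one_eq_diagonal]; rfl
  set J := G.dartReversalMatrix with hJ
  set S := G.dartStartMatrix
  set T := G.dartEndMatrix
  have hJJ : J * J = 1 := G.dartReversalMatrix_mul_self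
  have hSJ : S * J = T := G.dartStartMatrix_mul_dartReversalMatrix
  have hST : S * Tᵀ = G.adjMatrix ℂ := G.dartStartMatrix_mul_transpose_dartEndMatrix
  have hTT : T * Tᵀ = G.degMatrix ℂ := G.dartEndMatrix_mul_transpose_self
  have hprod : (z • 1 + J) * (z • 1 - J) = w • (1 : Matrix G.Dart G.Dart ℂ) := by
    rw [add_mul, mul_sub, mul_sub, hJJ]
    simp only [smul_mul_assoc, mul_smul_comm, one_mul, mul_one, smul_smul, hw_def, sub_smul, sq,
      one_smul]
    abel
  have hfac : z • 1 - (Tᵀ * S - J) =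
      (z • 1 + J) * (1 - ((w⁻¹ • (z • 1 - J)) * Tᵀ) * S) := by
    rw [mul_sub, mul_one, ← Matrix.mul_assoc, ← Matrix.mul_assoc, Matrix.mul_smul, hprod,
      smul_smul, inv_mul_cancel₀ hw, one_smul, Matrix.one_mul]
    abel
  have hdetJ : (z • 1 + J).det = w ^ G.edgeFinset.card := by
    have := congrArg (Polynomial.eval z) G.charpoly_neg_dartReversalMatrix
    rw [eval_charpoly, hs, sub_neg_eq_add] at this
    simpa using this
  have hpen : w • (1 - S * ((w⁻¹ • (z • 1 - J)) * Tᵀ)) = G.iharaPencil z := by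
    rw [Matrix.smul_mul, Matrix.mul_smul, smul_sub, smul_smul, mul_inv_cancel₀ hw, one_smul,
      Matrix.sub_mul, Matrix.mul_sub, ← Matrix.mul_assoc S J, hSJ, hTT, Matrix.smul_mul,
      Matrix.one_mul, Matrix.mul_smul, hST, iharaPencil]
    abel
  change eval z _ = eval z _
  rw [eval_mul, eval_mul, eval_charpoly_blockMatrixK G hz0, eval_charpoly, hs,
    nonBacktrackingMatrix_eq, hfac, det_mul, hdetJ, det_one_sub_mul_comm, ← hpen, det_smul]
  simp only [eval_pow, eval_sub, eval_X, eval_one, ← hw_def]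
  ring

end SimpleGraph

/-! ### Positivity of the quadratic pencil -/

namespace SimpleGraph

variable {V : Type*} [Fintype V] [DecidableEq V] (G : SimpleGraph V) [DecidableRel G.Adj]

theorem iharaPencil_one {R : Type*} [CommRing R] : G.iharaPencil (1 : R) = G.lapMatrix R := by
  rw [iharaPencil, lapMatrix]
  simp only [one_pow, sub_self, zero_smul, one_smul]
  abel

theorem iharaPencil_map_ofReal (t : ℝ) :
    (G.iharaPencil t).map Complex.ofReal = G.iharaPencil (t : ℂ) := by
  ext i j
  by_cases h : i = j <;> by_cases hij : G.Adj i j <;>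
    simp [iharaPencil, degMatrix, h, hij]

theorem det_iharaPencil_ofReal (t : ℝ) :
    (G.iharaPencil (t : ℂ)).det = ((G.iharaPencil t).det : ℂ) := by
  rw [← iharaPencil_map_ofReal]
  exact (RingHom.map_det Complex.ofRealHom _).symm

theorem isSymm_iharaPencil {R : Type*} [CommRing R] (z : R) : (G.iharaPencil z).IsSymm := by
  rw [iharaPencil]
  exact ((isSymm_one.smul _).sub (G.isSymm_adjMatrix.smul z)).add (G.isSymm_degMatrix R)

theorem dotProduct_iharaPencil_mulVec {R : Type*} [CommRing R] (z : R) (x : V → R) :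
    x ⬝ᵥ (G.iharaPencil z *ᵥ x) = ∑ i, (z ^ 2 - 1 + G.degree i) * x i ^ 2
      - z * ∑ i, ∑ j, if G.Adj i j then x i * x j else 0 := by
  rw [iharaPencil, add_mulVec, sub_mulVec, smul_mulVec, smul_mulVec, one_mulVec, dotProduct_add,
    dotProduct_sub, dotProduct_smul, dotProduct_smul, dotProduct_mulVec_degMatrix,
    dotProduct_mulVec_adjMatrix, smul_eq_mul, smul_eq_mul, dotProduct, Finset.mul_sum,
    sub_add_eq_add_sub, ← Finset.sum_add_distrib]
  congr 1
  exact Finset.sum_congr rfl fun i _ => by ring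

theorem posSemidef_iharaPencil_iff {t : ℝ} :
    (G.iharaPencil t).PosSemidef ↔ ∀ x : V → ℝ, 0 ≤ x ⬝ᵥ (G.iharaPencil t *ᵥ x) := by
  rw [posSemidef_iff_dotProduct_mulVec]
  simp only [star_trivial]
  refine and_iff_right ?_
  rw [IsHermitian, conjTranspose_eq_transpose_of_trivial, isSymm_iharaPencil]

/-- The pencil is `t L + (t - 1) (t + 1 - D)`, with `L` the positive semidefinite Laplacian. -/
theorem posSemidef_iharaPencil_of_forall_degree_le {t : ℝ} (ht : 1 ≤ t)
    (hd : ∀ i, (G.degree i : ℝ) ≤ t + 1) : (G.iharaPencil t).PosSemidef := by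
  have h : G.iharaPencil t =
      t • G.lapMatrix ℝ + (t - 1) • diagonal fun i => t + 1 - (G.degree i : ℝ) := by
    ext i j
    by_cases h : i = j
    · subst h
      simp [iharaPencil, degMatrix, lapMatrix]
      ring
    · simp [iharaPencil, degMatrix, lapMatrix, h]
  rw [h]
  exact ((G.posSemidef_lapMatrix ℝ).smul (by linarith)).add
    ((PosSemidef.diagonal fun i => by simpa using hd i).smul (by linarith))

/-- If the pencil has no singular real parameter beyond `r ≥ 1`, then it is positive semidefinite
from `r` on: it is so for large parameters, and its smallest value on the unit sphere, being
continuous in the parameter, cannot change sign without vanishing. -/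
theorem posSemidef_iharaPencil_of_det_ne_zero {r : ℝ} (hr : 1 ≤ r)
    (hdet : ∀ t, r < t → (G.iharaPencil t).det ≠ 0) {t : ℝ} (ht : r ≤ t) :
    (G.iharaPencil t).PosSemidef := by
  rw [posSemidef_iharaPencil_iff]
  by_contra! hneg
  obtain ⟨y, hy⟩ := hneg
  have hy0 : y ≠ 0 := by rintro rfl; simp at hy
  let K : Set (V → ℝ) := Metric.sphere 0 1
  have hK : IsCompact K := isCompact_sphere 0 1
  let q : ℝ → (V → ℝ) → ℝ := fun s x => x ⬝ᵥ (G.iharaPencil s *ᵥ x)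
  have hq : Continuous ↿q := by
    change Continuous fun p : ℝ × (V → ℝ) => p.2 ⬝ᵥ (G.iharaPencil p.1 *ᵥ p.2)
    simp only [dotProduct_iharaPencil_mulVec]
    refine .sub (by fun_prop) (.mul (by fun_prop) (continuous_finsetSum _ fun i _ =>
      continuous_finsetSum _ fun j _ => ?_))
    split_ifs <;> fun_prop
  have hqs : ∀ s (a : ℝ) x, q s (a • x) = a ^ 2 * q s x := fun s a x => by
    simp only [q, mulVec_smul, smul_dotProduct, dotProduct_smul, smul_eq_mul]; ring
  have hmem : ∀ x : V → ℝ, x ≠ 0 → ‖x‖⁻¹ • x ∈ K := fun x hx => by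
    simp [K, norm_smul, norm_ne_zero_iff.2 hx]
  have hKne : K.Nonempty := ⟨_, hmem y hy0⟩
  have hcont : ∀ s, Continuous (q s) := fun s => hq.comp (by fun_prop : Continuous fun x => (s, x))
  let f : ℝ → ℝ := fun s => sInf (q s '' K)
  have hf : Continuous f := hK.continuous_sInf hq
  have hfle : ∀ s, ∀ x ∈ K, f s ≤ q s x := fun s x hx =>
    csInf_le (hK.bddBelow_image (hcont s).continuousOn) ⟨x, hx, rfl⟩
  have hft : f t < 0 := by
    refine (hfle t _ (hmem y hy0)).trans_lt ?_
    rw [hqs]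
    exact mul_neg_of_pos_of_neg (by have := norm_pos_iff.2 hy0; positivity) hy
  set T : ℝ := max t (Fintype.card V) with hT
  have hfT : 0 ≤ f T := by
    refine le_csInf (hKne.image _) ?_
    rintro _ ⟨x, -, rfl⟩
    refine G.posSemidef_iharaPencil_iff.1 (G.posSemidef_iharaPencil_of_forall_degree_le
      (hr.trans (ht.trans (le_max_left _ _))) fun i => ?_) x
    have h1 : (G.degree i : ℝ) ≤ Fintype.card V := by exact_mod_cast (G.degree_lt_card_verts i).le
    linarith [le_max_right t (Fintype.card V : ℝ)]
  obtain ⟨s, hs, hs0⟩ := intermediate_value_Icc (le_max_left t (Fintype.card V : ℝ))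
    hf.continuousOn ⟨hft.le, hfT⟩
  have hts : t < s := hs.1.lt_of_ne (by rintro rfl; exact hft.ne hs0)
  have hpos : (G.iharaPencil s).PosSemidef := by
    rw [posSemidef_iharaPencil_iff]
    intro x
    rcases eq_or_ne x 0 with rfl | hx
    · simp
    have h := hfle s _ (hmem x hx)
    rw [hs0, hqs] at h
    exact nonneg_of_mul_nonneg_right h (by have := norm_pos_iff.2 hx; positivity)
  -- a minimiser at the parameter `s` lies in the kernel of the pencil
  obtain ⟨x, hxK, hx⟩ := hK.exists_sInf_image_eq hKne (hcont s).continuousOn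
  refine hdet s (ht.trans_lt hts) (exists_mulVec_eq_zero_iff.1 ⟨x, ?_, ?_⟩)
  · rintro rfl
    simp [K] at hxK
  · refine (hpos.dotProduct_mulVec_zero_iff x).1 ?_
    rw [star_trivial]
    exact hx.symm.trans hs0

/-- If `x` is in the kernel of the pencil at `-t`, then `|x|` minimises the quadratic form of the
pencil at `t`. This forces `x` to vanish nowhere and to change its sign along every edge. -/
theorem isBipartite_of_det_iharaPencil_neg_eq_zero (hG : G.Connected) {t : ℝ} (ht : 0 < t)
    (hpos : (G.iharaPencil t).PosSemidef) (hdet : (G.iharaPencil (-t)).det = 0) :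
    G.IsBipartite := by
  obtain ⟨x, hx0, hx⟩ := exists_mulVec_eq_zero_iff.2 hdet
  let y : V → ℝ := fun i => |x i|
  have hqx : x ⬝ᵥ (G.iharaPencil (-t) *ᵥ x) = 0 := by rw [hx, dotProduct_zero]
  have hqy := G.posSemidef_iharaPencil_iff.1 hpos y
  have hterm : ∀ i j, 0 ≤ if G.Adj i j then x i * x j + |x i| * |x j| else 0 := fun i j => by
    split_ifs
    · rw [← abs_mul]; linarith [neg_abs_le (x i * x j)]
    · exact le_rfl
  have hdiff : y ⬝ᵥ (G.iharaPencil t *ᵥ y) +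
      t * ∑ i, ∑ j, (if G.Adj i j then x i * x j + |x i| * |x j| else 0) = 0 := by
    refine Eq.trans ?_ hqx
    rw [dotProduct_iharaPencil_mulVec, dotProduct_iharaPencil_mulVec]
    simp only [y, sq_abs, neg_sq, ite_add_zero, Finset.sum_add_distrib]
    ring
  have hS := Finset.sum_nonneg fun i (_ : i ∈ Finset.univ) =>
    Finset.sum_nonneg fun j (_ : j ∈ Finset.univ) => hterm i j
  have hy0 : y ⬝ᵥ (G.iharaPencil t *ᵥ y) = 0 := by
    linarith [mul_nonneg ht.le hS]
  have hS0 : ∑ i, ∑ j, (if G.Adj i j then x i * x j + |x i| * |x j| else 0) = 0 := by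
    rw [hy0, zero_add] at hdiff
    exact (mul_eq_zero.1 hdiff).resolve_left ht.ne'
  have hedge : ∀ i j, G.Adj i j → x i * x j + |x i| * |x j| = 0 := fun i j hij => by
    have h1 := (Finset.sum_eq_zero_iff_of_nonneg fun i _ =>
      Finset.sum_nonneg fun j _ => hterm i j).1 hS0 i (Finset.mem_univ i)
    simpa [hij] using (Finset.sum_eq_zero_iff_of_nonneg fun j _ => hterm i j).1 h1 j
      (Finset.mem_univ j)
  have hPy : G.iharaPencil t *ᵥ y = 0 := (hpos.dotProduct_mulVec_zero_iff y).1 (by simpa using hy0)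
  -- a zero of `x` spreads to the neighbours, because `t * ∑ |x j| = 0` over the neighbours `j`
  have hstep : ∀ i j, G.Adj i j → x i = 0 → x j = 0 := by
    intro i j hij hi
    have h := congrFun hPy i
    rw [iharaPencil, add_mulVec, sub_mulVec, smul_mulVec, smul_mulVec, one_mulVec, Pi.add_apply,
      Pi.sub_apply, Pi.smul_apply, Pi.smul_apply, degMatrix_mulVec_apply,
      adjMatrix_mulVec_apply] at h
    have hyi : y i = 0 := by simp [y, hi]
    rw [hyi, smul_zero, mul_zero, zero_sub, add_zero, Pi.zero_apply, neg_eq_zero, smul_eq_mul] at h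
    have h' := (mul_eq_zero.1 h).resolve_left ht.ne'
    exact abs_eq_zero.1 ((Finset.sum_eq_zero_iff_of_nonneg fun j _ => abs_nonneg (x j)).1 h' j
      (by simpa using hij))
  have hne : ∀ i, x i ≠ 0 := by
    intro i hi
    refine hx0 (funext fun j => ?_)
    obtain ⟨w⟩ := hG.preconnected i j
    induction w with
    | nil => exact hi
    | cons h _ ih => exact ih (hstep _ _ h hi)
  refine ⟨Coloring.mk (fun v => if 0 < x v then (0 : Fin 2) else 1) fun {u v} huv => ?_⟩
  have h := hedge u v huv
  rcases (hne u).lt_or_gt with hu | hu <;> rcases (hne v).lt_or_gt with hv | hv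
  · nlinarith [mul_pos_of_neg_of_neg hu hv, mul_nonneg (abs_nonneg (x u)) (abs_nonneg (x v))]
  · simp [hu.not_gt, hv]
  · simp [hu, hv.not_gt]
  · nlinarith [mul_pos hu hv, mul_nonneg (abs_nonneg (x u)) (abs_nonneg (x v))]

/-- The quadratic form of the pencil at the constant vector `1` is `(t - 1) ((t + 1) n - 2 m)`,
with `n` vertices and `m` edges; letting `t` decrease to `1` gives `m ≤ n`. -/
theorem card_edgeFinset_le_card_of_posSemidef_iharaPencil [Nonempty V]
    (hpos : ∀ t : ℝ, 1 < t → (G.iharaPencil t).PosSemidef) :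
    G.edgeFinset.card ≤ Fintype.card V := by
  by_contra! hlt
  set n := Fintype.card V with hn
  have hn0 : (0 : ℝ) < n := by exact_mod_cast Fintype.card_pos (α := V)
  have hdeg : ∑ i, (G.degree i : ℝ) = 2 * G.edgeFinset.card := by
    exact_mod_cast G.sum_degrees_eq_twice_card_edges
  have hm : (n : ℝ) + 1 ≤ G.edgeFinset.card := by exact_mod_cast hlt
  -- with `m > n`, the form is already negative at `t = 1 + 1 / n`
  have h := G.posSemidef_iharaPencil_iff.1
    (hpos (1 + (n : ℝ)⁻¹) (by linarith [inv_pos.2 hn0])) fun _ => 1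
  rw [dotProduct_iharaPencil_mulVec] at h
  simp only [one_pow, mul_one, ← degree_eq_sum_if_adj, Finset.sum_add_distrib, hdeg,
    Finset.sum_const, Finset.card_univ, ← hn, nsmul_eq_mul] at h
  have hinv : (n : ℝ) * (n : ℝ)⁻¹ = 1 := mul_inv_cancel₀ hn0.ne'
  have hi := inv_pos.2 hn0
  set a := (n : ℝ)⁻¹
  have : (n : ℝ) * ((1 + a) ^ 2 - 1) + 2 * G.edgeFinset.card - (1 + a) * (2 * G.edgeFinset.card)
      = 2 * 1 + a - 2 * a * G.edgeFinset.card := by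
    linear_combination (2 + a) * hinv
  rw [this] at h
  nlinarith [mul_le_mul_of_nonneg_left hm hi.le]

end SimpleGraph

/-! ### Symmetric spectra and bipartite graphs -/

section SymmetricSpectrum

variable {ι : Type*} [Fintype ι] [DecidableEq ι] {M : Matrix ι ι ℂ}

theorem HasSymmetricSpectrumWithMult.hasSymmetricSpectrum (h : HasSymmetricSpectrumWithMult M) :
    HasSymmetricSpectrum M := fun z hz => by
  rw [mem_spectrum_iff_isRoot_charpoly, ← Polynomial.rootMultiplicity_pos M.charpoly_monic.ne_zero]
    at hz ⊢
  rwa [h z]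

theorem HasSymmetricSpectrum.isSmallestEigenvalue_neg (h : HasSymmetricSpectrum M) {r : ℝ}
    (hr : IsLargestEigenvalue M r) : IsSmallestEigenvalue M (-r) := by
  refine ⟨by simpa using h _ hr.1, fun z hz => ?_⟩
  have := hr.2 _ (h z hz)
  rw [Complex.neg_re] at this
  linarith

theorem IsLargestEigenvalue.of_norm_le {r : ℝ} (hr : (r : ℂ) ∈ spectrum ℂ M)
    (h : ∀ z ∈ spectrum ℂ M, ‖z‖ ≤ r) : IsLargestEigenvalue M r :=
  ⟨hr, fun z hz => (Complex.re_le_norm z).trans (h z hz)⟩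

open Polynomial in
/-- A matrix that is conjugate to its negative by a diagonal matrix of signs has a symmetric
spectrum. -/
theorem hasSymmetricSpectrumWithMult_of_sign {s : ι → ℂ} (hs : ∀ i, s i * s i = 1)
    (hM : ∀ i j, s i * M i j * s j = -M i j) : HasSymmetricSpectrumWithMult M := by
  have hconj : diagonal s * M * diagonal s = -M := by
    ext i j
    rw [mul_diagonal, diagonal_mul, hM, Matrix.neg_apply]
  have hneg : M.charpoly = (-M).charpoly := by
    rw [← hconj, charpoly_mul_comm, ← mul_assoc, diagonal_mul_diagonal]
    simp [hs]
  have hcomp : M.charpoly = C ((-1) ^ Fintype.card ι) * M.charpoly.comp (C (-1) * X + C 0) := by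
    refine Polynomial.funext fun z => ?_
    conv_lhs => rw [hneg]
    rw [eval_mul, eval_C, eval_comp, eval_charpoly, eval_charpoly, ← det_neg]
    congr 1
    ext i j
    by_cases h : i = j <;> simp [h, add_comm]
  intro z
  conv_rhs => rw [hcomp]
  rw [rootMultiplicity_mul (by rw [← hcomp]; exact M.charpoly_monic.ne_zero), rootMultiplicity_C,
    zero_add, rootMultiplicity_comp_C_mul_X_add_C _ _ _ _ (by simp)]
  simp

end SymmetricSpectrum

namespace SimpleGraph

variable {V : Type*} [Fintype V] [DecidableEq V] (G : SimpleGraph V) [DecidableRel G.Adj]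

omit [Fintype V] [DecidableEq V] [DecidableRel G.Adj] in
theorem IsBipartite.exists_sign {G : SimpleGraph V} (h : G.IsBipartite) :
    ∃ s : V → ℂ, (∀ v, s v * s v = 1) ∧ ∀ u v, G.Adj u v → s u * s v = -1 := by
  obtain ⟨c⟩ := h
  refine ⟨fun v => if c v = 0 then 1 else -1, fun v => by dsimp only; split_ifs <;> simp,
    fun u v huv => ?_⟩
  have := c.valid huv
  have h1 : ∀ a : Fin 2, a ≠ 0 → a = 1 := by decide
  by_cases hu : c u = 0 <;> by_cases hv : c v = 0 <;> simp [hu, hv]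
  · exact absurd (hu.trans hv.symm) this
  · exact absurd ((h1 _ hu).trans (h1 _ hv).symm) this

variable {G} in
theorem IsBipartite.hasSymmetricSpectrumWithMult_blockMatrixK (h : G.IsBipartite) :
    HasSymmetricSpectrumWithMult (blockMatrixK G) := by
  obtain ⟨s, hs, hadj⟩ := h.exists_sign
  -- the sign is reversed on the second copy of `V`, since the off-diagonal blocks are diagonal
  refine hasSymmetricSpectrumWithMult_of_sign (s := Sum.elim s fun v => -s v) ?_ ?_
  · rintro (v | v) <;> simp [hs]
  · rintro (u | u) (v | v)
    · by_cases huv : G.Adj u v <;> simp [blockMatrixK, huv, hadj]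
    · by_cases huv : u = v
      · subst huv
        simp only [blockMatrixK, fromBlocks_apply₁₂, Sum.elim_inl, Sum.elim_inr]
        linear_combination (-(degMatrix ℂ G - 1) u u) * hs u
      · simp [blockMatrixK, degMatrix, huv]
    · by_cases huv : u = v
      · subst huv
        simp [blockMatrixK, hs]
      · simp [blockMatrixK, huv]
    · simp [blockMatrixK]

variable {G} in
theorem IsBipartite.hasSymmetricSpectrumWithMult_nonBacktrackingMatrix (h : G.IsBipartite) :
    HasSymmetricSpectrumWithMult (nonBacktrackingMatrix G) := by
  obtain ⟨s, hs, hadj⟩ := h.exists_sign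
  refine hasSymmetricSpectrumWithMult_of_sign (s := fun e => s e.fst) (fun e => hs _) fun e f => ?_
  simp only [nonBacktrackingMatrix, of_apply]
  split_ifs with h
  · rw [← h.1, mul_one, hadj _ _ e.adj]
  · simp

theorem mem_spectrum_nonBacktrackingMatrix_iff {z : ℂ} (hz : z ^ 2 ≠ 1) :
    z ∈ spectrum ℂ (nonBacktrackingMatrix G) ↔ z ∈ spectrum ℂ (blockMatrixK G) := by
  have h := congrArg (Polynomial.eval z) G.ihara_bass
  simp only [Polynomial.eval_mul, Polynomial.eval_pow, Polynomial.eval_sub, Polynomial.eval_X,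
    Polynomial.eval_one] at h
  have hz' : z ^ 2 - 1 ≠ 0 := sub_ne_zero.2 hz
  rw [mem_spectrum_iff_isRoot_charpoly, mem_spectrum_iff_isRoot_charpoly, Polynomial.IsRoot,
    Polynomial.IsRoot]
  constructor <;> intro h0 <;> simpa [h0, hz'] using h

open Polynomial in
theorem rootMultiplicity_X_sq_sub_one_pow {ε : ℂ} (hε : ε ^ 2 = 1) (k : ℕ) :
    ((X ^ 2 - 1 : ℂ[X]) ^ k).rootMultiplicity ε = k := by
  have h0 : ε ≠ 0 := by rintro rfl; norm_num at hε
  have hfac : (X ^ 2 - 1 : ℂ[X]) = (X - C (-ε)) * (X - C ε) := by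
    rw [show (1 : ℂ[X]) = C (ε ^ 2) by rw [hε, C_1], C_pow, C_neg]
    ring
  have hne : ((X - C (-ε)) ^ k).eval ε ≠ 0 := by
    rw [eval_pow, eval_sub, eval_X, eval_C, sub_neg_eq_add, ← two_mul]
    exact pow_ne_zero _ (mul_ne_zero two_ne_zero h0)
  rw [hfac, mul_pow, rootMultiplicity_mul_X_sub_C_pow (pow_ne_zero _ (X_sub_C_ne_zero _)),
    rootMultiplicity_eq_zero hne, zero_add]

/-- Comparison of the multiplicities of `±1` in the Ihara–Bass formula. -/
theorem rootMultiplicity_nonBacktrackingMatrix_add_card {ε : ℂ} (hε : ε ^ 2 = 1) :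
    (nonBacktrackingMatrix G).charpoly.rootMultiplicity ε + Fintype.card V =
      G.edgeFinset.card + (blockMatrixK G).charpoly.rootMultiplicity ε := by
  have h := congrArg (Polynomial.rootMultiplicity ε) G.ihara_bass
  have hX : ∀ k, (Polynomial.X ^ 2 - 1 : Polynomial ℂ) ^ k ≠ 0 := fun k =>
    pow_ne_zero _ (Polynomial.monic_X_pow_sub_C (1 : ℂ) two_ne_zero).ne_zero
  rwa [Polynomial.rootMultiplicity_mul (mul_ne_zero (charpoly_monic _).ne_zero (hX _)),
    Polynomial.rootMultiplicity_mul (mul_ne_zero (hX _) (charpoly_monic _).ne_zero),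
    rootMultiplicity_X_sq_sub_one_pow hε, rootMultiplicity_X_sq_sub_one_pow hε] at h

theorem one_mem_spectrum_blockMatrixK [Nonempty V] : (1 : ℂ) ∈ spectrum ℂ (blockMatrixK G) := by
  rw [mem_spectrum_blockMatrixK_iff G one_ne_zero, iharaPencil_one]
  refine exists_mulVec_eq_zero_iff.1 ⟨fun _ => 1, fun h => ?_, G.lapMatrix_mulVec_const_eq_zero⟩
  exact one_ne_zero (congrFun h (Classical.arbitrary V))

theorem posSemidef_iharaPencil_of_norm_le {r : ℝ} (hr : 1 ≤ r)
    (h : ∀ z ∈ spectrum ℂ (blockMatrixK G), ‖z‖ ≤ r) {t : ℝ} (ht : r ≤ t) :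
    (G.iharaPencil t).PosSemidef := by
  refine G.posSemidef_iharaPencil_of_det_ne_zero hr (fun u hu h0 => ?_) ht
  have hu0 : 0 < u := by linarith
  have := h u ((mem_spectrum_blockMatrixK_iff G (by exact_mod_cast hu0.ne')).2 (by
    rw [det_iharaPencil_ofReal, h0, Complex.ofReal_zero]))
  rw [Complex.norm_real, Real.norm_of_nonneg hu0.le] at this
  linarith

variable {G} in
/-- An eigenvalue `-t` of `K` with `t > 0` makes `G` bipartite once the pencil is positive
semidefinite at `t`. -/
theorem isBipartite_of_neg_mem_spectrum_blockMatrixK (hG : G.Connected) {t : ℝ} (ht : 0 < t)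
    (hpos : (G.iharaPencil t).PosSemidef) (h : ((-t : ℝ) : ℂ) ∈ spectrum ℂ (blockMatrixK G)) :
    G.IsBipartite := by
  refine G.isBipartite_of_det_iharaPencil_neg_eq_zero hG ht hpos ?_
  rw [mem_spectrum_blockMatrixK_iff G (by simpa using ht.ne'), det_iharaPencil_ofReal] at h
  exact_mod_cast h

/-- If `K` has spectral radius `1`, then the graph has at most as many edges as vertices, and a
comparison of multiplicities shows that `-1` is an eigenvalue of `K` as soon as `-r` is one
of `B`, where `r` is the spectral radius of `B`. -/
theorem neg_one_mem_spectrum_blockMatrixK_of_norm_le_one [Nonempty V]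
    (hK : ∀ z ∈ spectrum ℂ (blockMatrixK G), ‖z‖ ≤ 1) {r : ℝ}
    (hB : ∀ z ∈ spectrum ℂ (nonBacktrackingMatrix G), ‖z‖ ≤ r) (hr1 : r ≤ 1)
    (hr : ((-r : ℝ) : ℂ) ∈ spectrum ℂ (nonBacktrackingMatrix G)) :
    (-1 : ℂ) ∈ spectrum ℂ (blockMatrixK G) := by
  have hcard := G.card_edgeFinset_le_card_of_posSemidef_iharaPencil fun t ht =>
    G.posSemidef_iharaPencil_of_norm_le le_rfl hK ht.le
  have h1 := G.rootMultiplicity_nonBacktrackingMatrix_add_card (ε := 1) (by norm_num)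
  have h2 := G.rootMultiplicity_nonBacktrackingMatrix_add_card (ε := -1) (by norm_num)
  have hmem : ∀ {ι : Type _} [Fintype ι] [DecidableEq ι] (M : Matrix ι ι ℂ) (z : ℂ),
      z ∈ spectrum ℂ M ↔ 0 < M.charpoly.rootMultiplicity z := fun M z => by
    rw [mem_spectrum_iff_isRoot_charpoly, Polynomial.rootMultiplicity_pos M.charpoly_monic.ne_zero]
  have hone := (hmem _ _).1 G.one_mem_spectrum_blockMatrixK
  rw [hmem]
  rcases hr1.eq_or_lt with rfl | hlt
  · have := (hmem _ _).1 hr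
    rw [Complex.ofReal_neg, Complex.ofReal_one] at this
    omega
  · have h3 : (nonBacktrackingMatrix G).charpoly.rootMultiplicity 1 = 0 := by
      by_contra h
      have := hB 1 ((hmem _ _).2 (Nat.pos_of_ne_zero h))
      rw [norm_one] at this
      linarith
    omega

end SimpleGraph

theorem mainTheorem3 {V : Type*} [Fintype V] [DecidableEq V] [Nontrivial V]
    (G : SimpleGraph V) [DecidableRel G.Adj] (hG : G.Connected) :
    ∃ lam₁ mu₁ : ℝ,
      (IsLargestEigenvalue (blockMatrixK G) lam₁ ∧
        ∀ z ∈ spectrum ℂ (blockMatrixK G), ‖z‖ ≤ lam₁) ∧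
      (IsLargestEigenvalue (nonBacktrackingMatrix G) mu₁ ∧
        ∀ z ∈ spectrum ℂ (nonBacktrackingMatrix G), ‖z‖ ≤ mu₁) ∧
      List.TFAE [
        G.IsBipartite,
        HasSymmetricSpectrum (blockMatrixK G),
        HasSymmetricSpectrumWithMult (blockMatrixK G),
        HasSymmetricSpectrum (nonBacktrackingMatrix G),
        HasSymmetricSpectrumWithMult (nonBacktrackingMatrix G),
        IsSmallestEigenvalue (blockMatrixK G) (-lam₁),
        IsSmallestEigenvalue (nonBacktrackingMatrix G) (-mu₁),
        (-1 : ℂ) ∈ spectrum ℂ (blockMatrixK G)] := by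
  have : Nonempty G.Dart := by
    obtain ⟨v⟩ := hG.nonempty
    obtain ⟨w, hw⟩ := hG.preconnected.exists_adj_of_nontrivial v
    exact ⟨⟨(v, w), hw⟩⟩
  obtain ⟨r, hr, hrB⟩ := Matrix.exists_mem_spectrum_norm_le_of_nonneg
    (N := nonBacktrackingMatrix G) (fun e f => by
      open scoped ComplexOrder in
      simp only [nonBacktrackingMatrix, of_apply]
      split_ifs
      exacts [zero_le_one, le_rfl])
  have hr0 : 0 ≤ r := (norm_nonneg _).trans (hrB _ hr)
  have hmemK : ∀ t : ℝ, 1 < |t| → (((t : ℝ) : ℂ) ∈ spectrum ℂ (nonBacktrackingMatrix G) ↔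
      (t : ℂ) ∈ spectrum ℂ (blockMatrixK G)) := fun t ht =>
    G.mem_spectrum_nonBacktrackingMatrix_iff fun h => by
      have h' : t ^ 2 = 1 := by exact_mod_cast h
      rw [← sq_abs] at h'
      nlinarith
  have hKB : ∀ z ∈ spectrum ℂ (blockMatrixK G), ‖z‖ ≤ max 1 r := fun z hz => by
    by_cases h : z ^ 2 = 1
    · have hz1 : ‖z‖ = 1 := (sq_eq_sq₀ (norm_nonneg z) zero_le_one).1 (by simp [← norm_pow, h])
      exact hz1 ▸ le_max_left _ _
    · exact (hrB z ((G.mem_spectrum_nonBacktrackingMatrix_iff h).2 hz)).trans (le_max_right _ _)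
  have hlam : ((max 1 r : ℝ) : ℂ) ∈ spectrum ℂ (blockMatrixK G) := by
    rcases le_or_gt r 1 with h | h
    · rw [max_eq_left h, Complex.ofReal_one]
      exact G.one_mem_spectrum_blockMatrixK
    · rw [max_eq_right h.le]
      exact (hmemK r (by rwa [abs_of_nonneg hr0])).1 hr
  have hK := IsLargestEigenvalue.of_norm_le hlam hKB
  have hB := IsLargestEigenvalue.of_norm_le hr hrB
  have hpos : 0 < max 1 r := zero_lt_one.trans_le (le_max_left _ _)
  have h61 : ((-(max 1 r) : ℝ) : ℂ) ∈ spectrum ℂ (blockMatrixK G) → G.IsBipartite :=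
    SimpleGraph.isBipartite_of_neg_mem_spectrum_blockMatrixK hG hpos
      (G.posSemidef_iharaPencil_of_norm_le (le_max_left _ _) hKB le_rfl)
  have h81 : (-1 : ℂ) ∈ spectrum ℂ (blockMatrixK G) → G.IsBipartite := fun h =>
    SimpleGraph.isBipartite_of_neg_mem_spectrum_blockMatrixK hG one_pos
      (by rw [SimpleGraph.iharaPencil_one]; exact G.posSemidef_lapMatrix ℝ) (by simpa using h)
  refine ⟨max 1 r, r, ⟨hK, hKB⟩, ⟨hB, hrB⟩, ?_⟩
  tfae_have 1 → 3 := fun h => h.hasSymmetricSpectrumWithMult_blockMatrixK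
  tfae_have 1 → 5 := fun h => h.hasSymmetricSpectrumWithMult_nonBacktrackingMatrix
  tfae_have 3 → 2 := fun h => h.hasSymmetricSpectrum
  tfae_have 5 → 4 := fun h => h.hasSymmetricSpectrum
  tfae_have 2 → 6 := fun h => h.isSmallestEigenvalue_neg hK
  tfae_have 4 → 7 := fun h => h.isSmallestEigenvalue_neg hB
  tfae_have 2 → 8 := fun h => h 1 G.one_mem_spectrum_blockMatrixK
  tfae_have 6 → 1 := fun h => h61 h.1
  tfae_have 8 → 1 := h81
  tfae_have 7 → 1 := by
    intro h
    rcases le_or_gt r 1 with h1 | h1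
    · exact h81 (G.neg_one_mem_spectrum_blockMatrixK_of_norm_le_one
        (by rwa [max_eq_left h1] at hKB) hrB h1 h.1)
    · refine h61 ?_
      rw [max_eq_right h1.le]
      exact (hmemK (-r) (by rwa [abs_neg, abs_of_nonneg hr0])).1 h.1
  tfae_finish
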